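/- For a set $C \subseteq \{0,1\}^m$ (a code), a \emph{chain of length $\ell$} in $C$ is a pair of injective maps $a : [\ell] \to [m]$ and $c : [\ell] \to C$ such that $c(i)_{a(i)} = 1$ for all $i \in [\ell]$ and $c(i)_{a(j)} = 0$ for all $1 \le i < j \le \ell$. The \emph{chain length} $\mathrm{CL}(C)$ is the length of the longest chain in $C$. For $\epsilon > 0$, a \emph{$(1 \pm \epsilon)$ sparsifier} of the (unweighted) code $C$ is a weight function $\widetilde{w} : [m] \to \mathbb{R}_{\ge 0}$ such that \[ (1-\epsilon) \sum_{i=1}^m c_i \;\le\; \sum_{i=1}^m \widetilde{w}(i)\, c_i \;\le\; (1+\epsilon) \sum_{i=1}^m c_i \qquad \text{for every } c \in C; \] it retains the coordinates in $\operatorname{supp}(\widetilde{w}) = \{ i \in [m] : \widetilde{w}(i) \ne 0 \}$. \textbf{Theorem.} There is an absolute constant $K > 0$ such that for every integer $m \ge 3$, every code $C \subseteq \{0,1\}^m$ and every $\epsilon > 0$, there exists a $(1 \pm \epsilon)$ sparsifier $\widetilde{w}$ of $C$ with \[ |\operatorname{supp}(\widetilde{w})| \;\le\; K \cdot \frac{\mathrm{CL}(C)\,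 (\log m)^2\, (\log\log m)^2}{\epsilon^2}, \] where $\log$ is the natural logarithm. -/

import Mathlib

namespace CodeSparsification

/-- A code: an arbitrary set of vectors in `{0,1}^m`, with `true` for `1` and `false` for `0`. -/
abbrev Code (m : ℕ) := Set (Fin m → Bool)

/-- A chain of length `ℓ` in the code `C`: injective maps `a : [ℓ] → [m]` and `c : [ℓ] → C` such
that `c(i)_{a(i)} = 1` for all `i`, and `c(i)_{a(j)} = 0` for all `i < j`. -/
structure IsChain {m ℓ : ℕ} (C : Code m) (a : Fin ℓ → Fin m) (c : Fin ℓ → Fin m → Bool) :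
    Prop where
  injective_coord : Function.Injective a
  injective_word : Function.Injective c
  mem : ∀ i, c i ∈ C
  diag : ∀ i, c i (a i) = true
  above : ∀ i j, i < j → c i (a j) = false

/-- The set of the lengths of all chains in `C`. -/
def chainLengths {m : ℕ} (C : Code m) : Set ℕ :=
  {ℓ | ∃ (a : Fin ℓ → Fin m) (c : Fin ℓ → Fin m → Bool), IsChain C a c}

/-- The chain length `CL(C)`: the length of the longest chain in `C`. -/
noncomputable def chainLength {m : ℕ} (C : Code m) : ℕ := sSup (chainLengths C)

theorem zero_mem_chainLengths {m : ℕ} (C : Code m) : 0 ∈ chainLengths C :=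
  ⟨Fin.elim0, Fin.elim0, fun i => i.elim0, fun i => i.elim0, fun i => i.elim0,
    fun i => i.elim0, fun i => i.elim0⟩

theorem le_of_mem_chainLengths {m ℓ : ℕ} {C : Code m} (h : ℓ ∈ chainLengths C) : ℓ ≤ m := by
  obtain ⟨a, c, h⟩ := h
  simpa using Fintype.card_le_of_injective a h.injective_coord

/-- The supremum that defines the chain length is a maximum. -/
theorem chainLength_isGreatest {m : ℕ} (C : Code m) :
    IsGreatest (chainLengths C) (chainLength C) :=
  have hb : BddAbove (chainLengths C) := ⟨m, fun _ h => le_of_mem_chainLengths h⟩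
  ⟨Nat.sSup_mem ⟨0, zero_mem_chainLengths C⟩ hb, fun _ h => le_csSup hb h⟩

/-- The weight `⟨w, c⟩ = ∑ i, w(i) c_i` of the codeword `c` under the weights `w`. -/
noncomputable def weight {m : ℕ} (w : Fin m → ℝ) (c : Fin m → Bool) : ℝ :=
  ∑ i, w i * (if c i then 1 else 0)

/-- `w'` is a `(1 ± ε)` sparsifier of the code `C` with weights `w`: the new weights are
nonnegative and `⟨w', c⟩ ∈ [(1 - ε) ⟨w, c⟩, (1 + ε) ⟨w, c⟩]` for every codeword `c ∈ C`. -/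
structure IsSparsifier {m : ℕ} (C : Code m) (w : Fin m → ℝ) (ε : ℝ) (w' : Fin m → ℝ) :
    Prop where
  nonneg : ∀ i, 0 ≤ w' i
  approx : ∀ c ∈ C, weight w' c ∈ Set.Icc ((1 - ε) * weight w c) ((1 + ε) * weight w c)

/-- The number of coordinates that the weights `w` retain, that is, `|supp(w)|`. -/
noncomputable def numRetained {m : ℕ} (w : Fin m → ℝ) : ℕ := (Function.support w).ncard

end CodeSparsification

/-! Identify codewords with their supports; `height` is then the chain length. It is superadditive:
words inside `I` and the words punctured at `I` have chains that concatenate (`hasChain_add`). Hence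
greedily deleting subfamilies with fewer than `d` support coordinates per unit of height removes at
most `d * height F` coordinates and leaves a `d`-dense family (`exists_isDense_sdiff`). Density
yields a counting bound like that of Karger for cuts: at most about `m ^ (3 * α)` words have size at
most `α * d` (`IsDense.card_filter_le`). So sampling at rate `p` of order `log m / (δ ^ 2 * d)`
survives a union bound, and one sample preserves all sizes up to `1 ± δ`. For support size `B * X ^
2` and height at most `k`, with `B` of order `k * log m / δ ^ 2`, the choice `d ≈ B * X / k` leaves
at most `B * X` coordinates both in the deleted set and in the sample. Recursing on both
(`hasWeights_of_card_supp_le`) takes `T`, of order `log log m`, levels and gives `2 ^ T`, of order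
`log m`, pieces of size at most `2 * B`. Taking `δ = ε / (2 * T)` keeps the accumulated error within
`ε`. -/

namespace CodeSparsification

/-! ### Chains in set families and superadditivity of the height. -/

section Height

open Finset

variable {V : Type*} [DecidableEq V]

/-- The union of the members of a family of finite sets. -/
def supp (F : Finset (Finset V)) : Finset V := F.biUnion id

theorem mem_supp {F : Finset (Finset V)} {i : V} : i ∈ supp F ↔ ∃ c ∈ F, i ∈ c := by
  simp [supp]

theorem subset_supp {F : Finset (Finset V)} {c : Finset V} (hc : c ∈ F) : c ⊆ supp F :=
  fun _ hi => mem_supp.2 ⟨c, hc, hi⟩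

theorem supp_mono {F G : Finset (Finset V)} (h : F ⊆ G) : supp F ⊆ supp G :=
  biUnion_subset_biUnion_of_subset_left _ h

theorem supp_image_inter_subset (F : Finset (Finset V)) (J : Finset V) :
    supp (F.image (· ∩ J)) ⊆ J := by
  intro i hi
  obtain ⟨c, hc, hic⟩ := mem_supp.1 hi
  obtain ⟨e, -, rfl⟩ := mem_image.1 hc
  exact (mem_inter.1 hic).2

theorem supp_image_sdiff_subset (F : Finset (Finset V)) (J : Finset V) :
    supp (F.image (· \ J)) ⊆ supp F := by
  intro i hi
  obtain ⟨c, hc, hic⟩ := mem_supp.1 hi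
  obtain ⟨e, he, rfl⟩ := mem_image.1 hc
  exact mem_supp.2 ⟨e, he, (mem_sdiff.1 hic).1⟩

/-- The members of `F` that avoid the coordinate `i`. -/
def avoid (F : Finset (Finset V)) (i : V) : Finset (Finset V) := F.filter (i ∉ ·)

theorem mem_avoid {F : Finset (Finset V)} {i : V} {c : Finset V} :
    c ∈ avoid F i ↔ c ∈ F ∧ i ∉ c := mem_filter

theorem avoid_subset (F : Finset (Finset V)) (i : V) : avoid F i ⊆ F := filter_subset _ _

theorem avoid_mono {F G : Finset (Finset V)} (h : F ⊆ G) (i : V) : avoid F i ⊆ avoid G i :=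
  filter_subset_filter _ h

/-- `F` has a chain of length `n`; the recursion strips the last coordinate of the chain. -/
def HasChain : ℕ → Finset (Finset V) → Prop
  | 0, _ => True
  | n + 1, F => ∃ i ∈ supp F, HasChain n (avoid F i)

theorem HasChain.mono {n : ℕ} {F G : Finset (Finset V)} (hF : HasChain n F) (h : F ⊆ G) :
    HasChain n G := by
  induction n generalizing F G with
  | zero => trivial
  | succ n ih =>
    obtain ⟨i, hi, hc⟩ := hF
    exact ⟨i, supp_mono h hi, ih hc (avoid_mono h i)⟩

theorem HasChain.le_card {n : ℕ} {F : Finset (Finset V)} (hF : HasChain n F) :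
    n ≤ (supp F).card := by
  induction n generalizing F with
  | zero => exact Nat.zero_le _
  | succ n ih =>
    obtain ⟨i, hi, hc⟩ := hF
    have h1 : supp (avoid F i) ⊂ supp F := by
      refine (ssubset_iff_of_subset (supp_mono (avoid_subset F i))).2 ⟨i, hi, fun h => ?_⟩
      obtain ⟨c, hc, hic⟩ := mem_supp.1 h
      exact (mem_avoid.1 hc).2 hic
    exact (ih hc).trans_lt (card_lt_card h1)

/-- The length of the longest chain of a family. -/
noncomputable def height (F : Finset (Finset V)) : ℕ := sSup {n | HasChain n F}

theorem bddAbove_hasChain (F : Finset (Finset V)) : BddAbove {n | HasChain n F} :=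
  ⟨_, fun _ h => HasChain.le_card h⟩

theorem hasChain_height (F : Finset (Finset V)) : HasChain (height F) F :=
  Nat.sSup_mem (s := {n | HasChain n F}) ⟨0, trivial⟩ (bddAbove_hasChain F)

theorem HasChain.le_height {n : ℕ} {F : Finset (Finset V)} (h : HasChain n F) : n ≤ height F :=
  le_csSup (bddAbove_hasChain F) h

/-- A longest chain of words avoiding `i` extends by `i` itself. This strict drop drives the
inductions on height below. -/
theorem height_avoid_lt {F : Finset (Finset V)} {i : V} (hi : i ∈ supp F) :
    height (avoid F i) < height F :=
  HasChain.le_height (n := height (avoid F i) + 1) ⟨i, hi, hasChain_height _⟩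

theorem height_pos {F : Finset (Finset V)} {i : V} (hi : i ∈ supp F) : 0 < height F :=
  (Nat.zero_le _).trans_lt (height_avoid_lt hi)

/-- A chain of words supported in `I` extends by a chain of the words punctured at `I`. -/
theorem hasChain_add {a b : ℕ} {F G : Finset (Finset V)} {I : Finset V} (hGF : G ⊆ F)
    (hI : ∀ c ∈ G, c ⊆ I) (ha : HasChain a G) (hb : HasChain b (F.image (· \ I))) :
    HasChain (a + b) F := by
  induction b generalizing F with
  | zero => exact ha.mono hGF
  | succ b ih =>
    obtain ⟨i, hi, hc⟩ := hb
    obtain ⟨e, he, hic⟩ := mem_supp.1 hi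
    obtain ⟨c, hcF, rfl⟩ := mem_image.1 he
    rw [mem_sdiff] at hic
    -- The last coordinate `i` lies outside `I`, so every word of `G` avoids it and `G` survives in
    -- `avoid F i`.
    refine ⟨i, mem_supp.2 ⟨c, hcF, hic.1⟩, ih ?_ (hc.mono ?_)⟩
    · exact fun e he => mem_avoid.2 ⟨hGF he, fun h => hic.2 (hI e he h)⟩
    · intro e he
      obtain ⟨he, hie⟩ := mem_avoid.1 he
      obtain ⟨e, heF, rfl⟩ := mem_image.1 he
      refine mem_image.2 ⟨e, mem_avoid.2 ⟨heF, fun h => hie ?_⟩, rfl⟩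
      exact mem_sdiff.2 ⟨h, hic.2⟩

theorem height_add_height_sdiff_le {F G : Finset (Finset V)} {I : Finset V} (hGF : G ⊆ F)
    (hI : ∀ c ∈ G, c ⊆ I) : height G + height (F.image (· \ I)) ≤ height F :=
  (hasChain_add hGF hI (hasChain_height _) (hasChain_height _)).le_height

theorem height_image_inter_le [Fintype V] (F : Finset (Finset V)) (J : Finset V) :
    height (F.image (· ∩ J)) ≤ height F := by
  -- Restricting to `J` is puncturing at its complement.
  have h := height_add_height_sdiff_le (F := F) (G := ∅) (I := Jᶜ) (by simp) (by simp)
  simp only [sdiff_compl] at h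
  exact (Nat.le_add_left _ _).trans h

theorem HasChain.exists_maps {n : ℕ} {F : Finset (Finset V)} (hF : HasChain n F) :
    ∃ (a : Fin n → V) (c : Fin n → Finset V),
      (∀ i, c i ∈ F) ∧ (∀ i, a i ∈ c i) ∧ ∀ i j, i < j → a j ∉ c i := by
  induction n generalizing F with
  | zero => exact ⟨Fin.elim0, Fin.elim0, fun i => i.elim0, fun i => i.elim0, fun i => i.elim0⟩
  | succ n ih =>
    obtain ⟨x, hx, hc⟩ := hF
    obtain ⟨e, heF, hxe⟩ := mem_supp.1 hx
    obtain ⟨a, c, h1, h2, h3⟩ := ih hc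
    refine ⟨Fin.snoc (α := fun _ => V) a x, Fin.snoc (α := fun _ => Finset V) c e, ?_, ?_, ?_⟩
    · intro i
      induction i using Fin.lastCases with
      | last => simpa using heF
      | cast i => simpa using (mem_avoid.1 (h1 i)).1
    · intro i
      induction i using Fin.lastCases with
      | last => simpa using hxe
      | cast i => simpa using h2 i
    · intro i j hij
      induction i using Fin.lastCases with
      | last => exact absurd hij (Fin.le_last j).not_gt
      | cast i =>
        induction j using Fin.lastCases with
        | last => simpa using (mem_avoid.1 (h1 i)).2
        | cast j => simpa using h3 i j (by simpa using hij)

end Height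

/-! ### Dense families: decomposition and counting of small words. -/

section Dense

open Finset

variable {V : Type*} [DecidableEq V]

/-- Every subfamily has at least `d` coordinates in its support per unit of height. -/
def IsDense (d : ℕ) (F : Finset (Finset V)) : Prop :=
  ∀ G ⊆ F, d * height G ≤ (supp G).card

theorem IsDense.subset {d : ℕ} {F G : Finset (Finset V)} (hF : IsDense d F) (h : G ⊆ F) :
    IsDense d G := fun H hH => hF H (hH.trans h)

theorem IsDense.le_card {d : ℕ} {F : Finset (Finset V)} (hF : IsDense d F) {c : Finset V}
    (hc : c ∈ F) (hne : c.Nonempty) : d ≤ c.card := by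
  have h := hF {c} (by simpa using hc)
  have hs : supp ({c} : Finset (Finset V)) = c := by simp [supp]
  obtain ⟨i, hi⟩ := hne
  have hp : 0 < height ({c} : Finset (Finset V)) := height_pos (i := i) (by rwa [hs])
  rw [hs] at h
  exact (Nat.le_mul_of_pos_right d hp).trans h

/-- A subfamily violating density has a support cheaper than `d` per unit of its height. Puncturing
there lowers the height by at least that much, so the total cost telescopes. -/
theorem exists_isDense_sdiff (d : ℕ) (F : Finset (Finset V)) :
    ∃ I : Finset V, I.card ≤ d * height F ∧ IsDense d (F.image (· \ I)) := by
  induction hk : height F using Nat.strong_induction_on generalizing F with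
  | _ k ih =>
    subst hk
    by_cases hF : IsDense d F
    · exact ⟨∅, by simp, by simpa using hF⟩
    · unfold IsDense at hF
      push Not at hF
      obtain ⟨G, hG, hlt⟩ := hF
      have hadd := height_add_height_sdiff_le (I := supp G) hG fun c hc => subset_supp hc
      have hpos : 0 < height G := Nat.pos_of_ne_zero fun h => by simp [h] at hlt
      obtain ⟨I, hI, hd⟩ := ih (height (F.image (· \ supp G))) (by omega) _ rfl
      refine ⟨supp G ∪ I, ?_, ?_⟩
      · calc (supp G ∪ I).card ≤ (supp G).card + I.card := card_union_le _ _
          _ ≤ d * height G + d * height (F.image (· \ supp G)) := by omega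
          _ ≤ d * height F := by rw [← mul_add]; gcongr
      · rw [image_image] at hd
        convert hd using 3
        simp [sdiff_sdiff_left]

/-- Every word is either the full support or avoids some coordinate of it, and hence lies in one of
at most `Fintype.card V` families of smaller height. -/
theorem card_le_succ_pow [Fintype V] {k : ℕ} {F : Finset (Finset V)} (hk : height F ≤ k) :
    F.card ≤ (Fintype.card V + 1) ^ k := by
  induction k generalizing F with
  | zero =>
    have h : F ⊆ {∅} := by
      intro c hc
      rw [mem_singleton, eq_empty_iff_forall_notMem]
      intro i hi
      exact (height_pos (subset_supp hc hi)).not_ge hk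
    simpa using card_le_card h
  | succ k ih =>
    have h : F ⊆ insert (supp F) ((supp F).biUnion (avoid F)) := by
      intro c hc
      by_cases he : c = supp F
      · simp [he]
      · obtain ⟨i, hi, hic⟩ := exists_of_ssubset ((subset_supp hc).ssubset_of_ne he)
        exact mem_insert_of_mem (mem_biUnion.2 ⟨i, hi, mem_avoid.2 ⟨hc, hic⟩⟩)
    have hb : ∀ i ∈ supp F, (avoid F i).card ≤ (Fintype.card V + 1) ^ k := fun i hi =>
      ih (by have := height_avoid_lt hi; omega)
    calc F.card ≤ ((supp F).biUnion (avoid F)).card + 1 :=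
          (card_le_card h).trans (card_insert_le _ _)
      _ ≤ (supp F).card * (Fintype.card V + 1) ^ k + 1 := by
          gcongr; exact card_biUnion_le_card_mul _ _ _ hb
      _ ≤ Fintype.card V * (Fintype.card V + 1) ^ k + (Fintype.card V + 1) ^ k := by
          gcongr
          · exact card_le_univ _
          · exact Nat.one_le_pow _ _ (Nat.succ_pos _)
      _ = (Fintype.card V + 1) ^ (k + 1) := by ring

/-- Double counting of the pairs of a word of size at most `w` and a coordinate it avoids. -/
theorem card_filter_mul_le (F : Finset (Finset V)) (w : ℕ) :
    (F.filter (·.card ≤ w)).card * ((supp F).card - w) ≤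
      ∑ i ∈ supp F, ((avoid F i).filter (·.card ≤ w)).card := by
  have h1 : ∀ i, (avoid F i).filter (·.card ≤ w) = (F.filter (·.card ≤ w)).filter (i ∉ ·) := by
    intro i; simp only [avoid, filter_filter, and_comm]
  simp only [h1]
  change _ ≤ ∑ i ∈ supp F,
    (bipartiteAbove (fun i (c : Finset V) => i ∉ c) (F.filter (·.card ≤ w)) i).card
  rw [sum_card_bipartiteAbove_eq_sum_card_bipartiteBelow]
  rw [← smul_eq_mul]
  refine card_nsmul_le_sum _ _ _ fun c hc => ?_
  rw [mem_filter] at hc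
  have : supp F \ c ⊆ (supp F).bipartiteBelow (fun i (c : Finset V) => i ∉ c) c := by
    intro i hi
    rw [mem_sdiff] at hi
    simp [bipartiteBelow, hi]
  refine le_trans ?_ (card_le_card this)
  have := le_card_sdiff c (supp F)
  omega

/-- A deterministic form of random contraction: a word of size at most `α * d` misses most
coordinates of a dense support, so averaging over `avoid F i` loses only the factor `(R + 1) / (R +
1 - α)`. These factors multiply to the binomial coefficient. -/
theorem IsDense.card_filter_le [Fintype V] {d α R : ℕ} (hd : 0 < d) {F : Finset (Finset V)}
    (hF : IsDense d F) (hR : height F ≤ R) (hα : α ≤ R) :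
    (F.filter (·.card ≤ α * d)).card ≤ R.choose α * (Fintype.card V + 1) ^ α := by
  induction R, hα using Nat.le_induction generalizing F with
  | base =>
    rw [Nat.choose_self, one_mul]
    exact (Finset.card_filter_le _ _).trans (card_le_succ_pow hR)
  | succ R hα ih =>
    rcases hR.lt_or_eq with h | h
    · refine (ih hF (Nat.lt_succ_iff.1 h)).trans ?_
      gcongr
      exact Nat.le_succ R
    · set N := (F.filter (·.card ≤ α * d)).card
      set M := (Fintype.card V + 1) ^ α
      set s := (supp F).card
      have hs : d * (R + 1) ≤ s := h ▸ hF F subset_rfl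
      have h1 : N * (s - α * d) ≤ s * (R.choose α * M) := by
        refine (card_filter_mul_le F (α * d)).trans ?_
        rw [← smul_eq_mul]
        refine sum_le_card_nsmul _ _ _ fun i hi => ?_
        exact ih (hF.subset (avoid_subset F i)) (by have := height_avoid_lt hi; omega)
      have h2 : (R + 1) * R.choose α = (R + 1).choose α * (R + 1 - α) := by
        rw [mul_comm]; exact Nat.choose_mul_succ_eq R α
      have hs0 : 0 < s := lt_of_lt_of_le (by positivity) hs
      -- After cancellation this is `α` times the density bound `hs`.
      have h3 : (R + 1 - α) * s ≤ (R + 1) * (s - α * d) := by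
        have : α * d ≤ s := by nlinarith
        zify [this, (by omega : α ≤ R + 1)]
        zify at hs
        nlinarith
      have h4 : s * (R + 1 - α) * N ≤ s * (R + 1 - α) * ((R + 1).choose α * M) := by
        calc s * (R + 1 - α) * N = N * ((R + 1 - α) * s) := by ring
          _ ≤ N * ((R + 1) * (s - α * d)) := by gcongr
          _ = (R + 1) * (N * (s - α * d)) := by ring
          _ ≤ (R + 1) * (s * (R.choose α * M)) := by gcongr
          _ = ((R + 1) * R.choose α) * (s * M) := by ring
          _ = s * (R + 1 - α) * ((R + 1).choose α * M) := by rw [h2]; ring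
      exact Nat.le_of_mul_le_mul_left h4 (Nat.mul_pos hs0 (by omega))

end Dense

/-! ### Independent sampling, Chernoff bounds and the union bound. -/

section Sampling

open Finset

variable {V : Type*} [DecidableEq V] [Fintype V]

/-- The probability of `S` if every coordinate is retained independently with probability `p`. -/
noncomputable def sampleProb (p : ℝ) (S : Finset V) : ℝ := (∏ _i ∈ S, p) * ∏ _i ∈ univ \ S, (1 - p)

theorem sampleProb_nonneg {p : ℝ} (h0 : 0 ≤ p) (h1 : p ≤ 1) (S : Finset V) :
    0 ≤ sampleProb p S :=
  mul_nonneg (prod_nonneg fun _ _ => h0) (prod_nonneg fun _ _ => sub_nonneg.2 h1)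

theorem sum_sampleProb (p : ℝ) : ∑ S : Finset V, sampleProb p S = 1 := by
  have h := prod_add (fun _ : V => p) (fun _ => 1 - p) univ
  rw [powerset_univ] at h
  simpa [sampleProb] using h.symm

/-- The moment generating function of a binomial variable, read off from the expansion of a product
of sums. -/
theorem sum_sampleProb_mul_exp (p t : ℝ) (c : Finset V) :
    ∑ S : Finset V, sampleProb p S * Real.exp (t * (c ∩ S).card) =
      (1 + p * (Real.exp t - 1)) ^ c.card := by
  have h := prod_add (fun i : V => p * if i ∈ c then Real.exp t else 1) (fun _ => 1 - p) univ
  rw [powerset_univ] at h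
  have h1 : ∀ S : Finset V, sampleProb p S * Real.exp (t * (c ∩ S).card) =
      (∏ i ∈ S, p * if i ∈ c then Real.exp t else 1) * ∏ i ∈ univ \ S, (1 - p) := by
    intro S
    rw [prod_mul_distrib, prod_ite_mem, prod_const (Real.exp t), mul_comm t, Real.exp_nat_mul, sampleProb,
      inter_comm]
    ring
  rw [sum_congr rfl fun S _ => h1 S, ← h, ← prod_const, ← prod_subset (subset_univ c)]
  · refine prod_congr rfl fun i hi => ?_
    rw [if_pos hi]; ring
  · intro i _ hi
    rw [if_neg hi]; ring

theorem sum_sampleProb_mul_exp_le {p t : ℝ} (h0 : 0 ≤ p) (h1 : p ≤ 1) (ht : |t| ≤ 1)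
    (c : Finset V) :
    ∑ S : Finset V, sampleProb p S * Real.exp (t * (c ∩ S).card) ≤
      Real.exp (p * c.card * (t + t ^ 2)) := by
  have h2 := (abs_le.1 (Real.abs_exp_sub_one_sub_id_le ht)).2
  rw [sum_sampleProb_mul_exp]
  calc (1 + p * (Real.exp t - 1)) ^ c.card
      ≤ (Real.exp (p * (t + t ^ 2))) ^ c.card := by
        refine pow_le_pow_left₀ ?_ ?_ _
        · nlinarith [Real.exp_pos t]
        · calc 1 + p * (Real.exp t - 1) ≤ p * (t + t ^ 2) + 1 := by nlinarith
            _ ≤ _ := Real.add_one_le_exp _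
    _ = _ := by rw [← Real.exp_nat_mul]; ring_nf

/-- The sample `S` estimates the size of `c` within relative error `δ`. -/
def IsGoodSample (p δ : ℝ) (c S : Finset V) : Prop :=
  (1 - δ) * (p * c.card) ≤ (c ∩ S).card ∧ ((c ∩ S).card : ℝ) ≤ (1 + δ) * (p * c.card)

-- Chernoff bound: the indicator of failure is dominated by two exponential moments, at `t = δ / 2`
-- and `t = -(δ / 2)`.
open Classical in
theorem sum_sampleProb_not_isGoodSample_le {p δ : ℝ} (h0 : 0 ≤ p) (h1 : p ≤ 1) (hδ0 : 0 ≤ δ)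
    (hδ1 : δ ≤ 1) (c : Finset V) :
    ∑ S : Finset V, sampleProb p S * (if IsGoodSample p δ c S then 0 else 1) ≤
      2 * Real.exp (-(δ ^ 2 * p / 4 * c.card)) := by
  have hup := sum_sampleProb_mul_exp_le (t := δ / 2) h0 h1 (by rw [abs_le]; constructor <;> linarith) c
  have hlo := sum_sampleProb_mul_exp_le (t := -(δ / 2)) h0 h1
    (by rw [abs_le]; constructor <;> linarith) c
  set A := Real.exp (-(δ / 2 * ((1 + δ) * (p * c.card))))
  set B := Real.exp (δ / 2 * ((1 - δ) * (p * c.card)))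
  have hpt : ∀ S : Finset V, sampleProb p S * (if IsGoodSample p δ c S then 0 else 1) ≤
      A * (sampleProb p S * Real.exp (δ / 2 * (c ∩ S).card)) +
        B * (sampleProb p S * Real.exp (-(δ / 2) * (c ∩ S).card)) := by
    intro S
    have e1 : A * (sampleProb p S * Real.exp (δ / 2 * (c ∩ S).card)) = sampleProb p S *
        Real.exp (δ / 2 * ((c ∩ S).card - (1 + δ) * (p * c.card))) := by
      rw [mul_left_comm, ← Real.exp_add]; ring_nf
    have e2 : B * (sampleProb p S * Real.exp (-(δ / 2) * (c ∩ S).card)) = sampleProb p S *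
        Real.exp (δ / 2 * ((1 - δ) * (p * c.card) - (c ∩ S).card)) := by
      rw [mul_left_comm, ← Real.exp_add]; ring_nf
    rw [e1, e2, ← mul_add]
    refine mul_le_mul_of_nonneg_left ?_ (sampleProb_nonneg h0 h1 S)
    split_ifs with h
    · positivity
    · rw [IsGoodSample, not_and_or, not_le, not_le] at h
      rcases h with h | h
      · refine le_add_of_nonneg_of_le (Real.exp_pos _).le (Real.one_le_exp ?_)
        exact mul_nonneg (by linarith) (by linarith)
      · refine le_add_of_le_of_nonneg (Real.one_le_exp ?_) (Real.exp_pos _).le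
        exact mul_nonneg (by linarith) (by linarith)
  refine (sum_le_sum fun S _ => hpt S).trans ?_
  rw [sum_add_distrib, ← mul_sum, ← mul_sum, two_mul]
  refine add_le_add ?_ ?_
  · refine (mul_le_mul_of_nonneg_left hup (Real.exp_pos _).le).trans ?_
    rw [← Real.exp_add]
    exact Real.exp_le_exp.2 (le_of_eq (by ring))
  · refine (mul_le_mul_of_nonneg_left hlo (Real.exp_pos _).le).trans ?_
    rw [← Real.exp_add]
    exact Real.exp_le_exp.2 (le_of_eq (by ring))

theorem exists_isGoodSample {p δ : ℝ} (h0 : 0 ≤ p) (h1 : p ≤ 1) (hδ0 : 0 ≤ δ) (hδ1 : δ ≤ 1)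
    (F : Finset (Finset V))
    (hF : ∑ c ∈ F, 2 * Real.exp (-(δ ^ 2 * p / 4 * c.card)) < 1) :
    ∃ S : Finset V, ∀ c ∈ F, IsGoodSample p δ c S := by
  classical
  -- If every sample failed for some word, the failure probabilities would sum to at least 1.
  by_contra! hbad
  have h : (1 : ℝ) ≤ ∑ S : Finset V, ∑ c ∈ F,
      (sampleProb p S * if IsGoodSample p δ c S then 0 else 1) := by
    refine (sum_sampleProb (V := V) p).symm.le.trans ?_
    refine sum_le_sum fun S _ => ?_
    obtain ⟨c, hc, hcS⟩ := hbad S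
    have hnn : ∀ c ∈ F, 0 ≤ sampleProb p S * (if IsGoodSample p δ c S then 0 else 1) :=
      fun c _ => mul_nonneg (sampleProb_nonneg h0 h1 S) (by split_ifs <;> norm_num)
    refine le_trans ?_ (single_le_sum hnn hc)
    rw [if_neg hcS, mul_one]
  rw [sum_comm] at h
  refine (h.trans (sum_le_sum fun c _ => ?_)).not_gt hF
  exact sum_sampleProb_not_isGoodSample_le h0 h1 hδ0 hδ1 c

theorem inv_pow_eq_exp {x : ℝ} (hx : 0 < x) (n : ℕ) :
    (x ^ n)⁻¹ = Real.exp (-(n * Real.log x)) := by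
  rw [Real.exp_neg, Real.exp_nat_mul, Real.exp_log hx]

/-- In a dense family the words of size `w` contribute little to the union bound. -/
theorem IsDense.card_mul_exp_le {d w : ℕ} {l : ℝ} {F : Finset (Finset V)} (hd : 0 < d)
    (hF : IsDense d F) (hV : 3 ≤ Fintype.card V) (hl : 9 * Real.log (Fintype.card V) ≤ l * d)
    (hdw : d ≤ w) (hw : w ≤ Fintype.card V) :
    ((F.filter (·.card = w)).card : ℝ) * Real.exp (-(l * w)) ≤
      ((Fintype.card V : ℝ) ^ 3)⁻¹ := by
  set m := Fintype.card V
  have hm : (3 : ℝ) ≤ m := by exact_mod_cast hV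
  have hlog : 0 ≤ Real.log m := Real.log_nonneg (by linarith)
  -- The ceiling of `w / d`; rounding up costs at most a factor 2 because `d ≤ w`.
  set α := (w + d - 1) / d
  have hα1 : α * d ≤ 2 * w := (Nat.div_mul_le_self _ _).trans (by omega)
  have hα2 : w ≤ α * d := by
    have : w + d - 1 < α * d + d := Nat.lt_div_mul_add hd
    omega
  have hαm : α ≤ m := by
    refine le_trans ?_ hw
    refine Nat.div_le_of_le_mul ?_
    have := Nat.mul_le_mul hd (le_refl 1)
    nlinarith [Nat.sub_add_cancel (by omega : 1 ≤ w + d)]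
  have hh : height F ≤ m := (hasChain_height F).le_card.trans (card_le_univ _)
  have hN : (F.filter (·.card = w)).card ≤ (m ^ 3) ^ α := by
    calc (F.filter (·.card = w)).card ≤ (F.filter (·.card ≤ α * d)).card :=
          card_le_card (monotone_filter_right _ fun c _ hc => by
            exact hc.trans_le hα2)
      _ ≤ m.choose α * (m + 1) ^ α := hF.card_filter_le hd hh hαm
      _ ≤ m ^ α * (m + 1) ^ α := by gcongr; exact Nat.choose_le_pow _ _
      _ = (m * (m + 1)) ^ α := (mul_pow _ _ _).symm
      _ ≤ (m ^ 3) ^ α := by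
          refine Nat.pow_le_pow_left ?_ _
          nlinarith [Nat.mul_le_mul hV hV]
  have hN' : ((F.filter (·.card = w)).card : ℝ) ≤ Real.exp (3 * α * Real.log m) := by
    have e : Real.exp (3 * α * Real.log m) = ((m : ℝ) ^ 3) ^ α := by
      rw [← pow_mul, ← Real.exp_log (by linarith : (0 : ℝ) < m), ← Real.exp_nat_mul,
        Real.log_exp]
      push_cast; rfl
    rw [e]; exact_mod_cast hN
  have e3 : ((m : ℝ) ^ 3)⁻¹ = Real.exp (-(3 * Real.log m)) := by
    rw [inv_pow_eq_exp (by linarith), Nat.cast_ofNat]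
  rw [e3]
  refine (mul_le_mul_of_nonneg_right hN' (Real.exp_pos _).le).trans ?_
  rw [← Real.exp_add, Real.exp_le_exp]
  have hdr : (0 : ℝ) < d := by exact_mod_cast hd
  have hα1' : (α : ℝ) * d ≤ 2 * w := by exact_mod_cast hα1
  have hdw' : (d : ℝ) ≤ w := by exact_mod_cast hdw
  have key : (3 * α * Real.log m + 3 * Real.log m) * d ≤ (l * w) * d := by
    calc (3 * α * Real.log m + 3 * Real.log m) * d
        = 3 * Real.log m * (α * d + d) := by ring
      _ ≤ 3 * Real.log m * (2 * w + w) := by gcongr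
      _ = 9 * Real.log m * w := by ring
      _ ≤ l * d * w := by gcongr
      _ = (l * w) * d := by ring
  have := le_of_mul_le_mul_right key hdr
  linarith

/-- Group the words by size: there are `m` nonzero sizes, each contributing at most `m ^ (-3)`. -/
theorem IsDense.sum_exp_le {d : ℕ} {l : ℝ} {F : Finset (Finset V)} (hd : 0 < d)
    (hF : IsDense d F) (hV : 3 ≤ Fintype.card V)
    (hl : 9 * Real.log (Fintype.card V) ≤ l * d) :
    ∑ c ∈ F.erase ∅, Real.exp (-(l * c.card)) ≤ ((Fintype.card V : ℝ) ^ 2)⁻¹ := by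
  set m := Fintype.card V
  have hm : (3 : ℝ) ≤ m := by exact_mod_cast hV
  have hmaps : ∀ c ∈ F.erase ∅, c.card ∈ Icc 1 m := fun c hc =>
    mem_Icc.2 ⟨card_pos.2 (nonempty_iff_ne_empty.2 (mem_erase.1 hc).1), card_le_univ c⟩
  rw [← sum_fiberwise_of_maps_to hmaps]
  calc _ ≤ ∑ _w ∈ Icc 1 m, ((m : ℝ) ^ 3)⁻¹ := by
        refine sum_le_sum fun w hw => ?_
        rcases (filter (fun c => c.card = w) (F.erase ∅)).eq_empty_or_nonempty with he | ⟨c, hcw⟩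
        · rw [he, sum_empty]; positivity
        · obtain ⟨hce, rfl⟩ := mem_filter.1 hcw
          obtain ⟨hne, hc⟩ := mem_erase.1 hce
          have hdc := hF.le_card hc (nonempty_iff_ne_empty.2 hne)
          refine le_trans ?_ (hF.card_mul_exp_le hd hV hl hdc (card_le_univ c))
          rw [sum_congr rfl (g := fun _ => Real.exp (-(l * c.card)))
            fun e he => by rw [(mem_filter.1 he).2], sum_const, nsmul_eq_mul]
          gcongr
          exact erase_subset _ _
    _ = ((m : ℝ) ^ 2)⁻¹ := by
        rw [sum_const, Nat.card_Icc, nsmul_eq_mul, Nat.add_sub_cancel]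
        field_simp

theorem IsDense.exists_isGoodSample {d : ℕ} {p δ : ℝ} {F : Finset (Finset V)} (hd : 0 < d)
    (hF : IsDense d F) (hV : 3 ≤ Fintype.card V) (h0 : 0 ≤ p) (h1 : p ≤ 1) (hδ0 : 0 ≤ δ)
    (hδ1 : δ ≤ 1) (hp : 36 * Real.log (Fintype.card V) ≤ δ ^ 2 * p * d) :
    ∃ S : Finset V, (S.card : ℝ) ≤ 2 * p * (supp F).card ∧ ∀ c ∈ F, IsGoodSample p δ c S := by
  have hm : (3 : ℝ) ≤ Fintype.card V := by exact_mod_cast hV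
  have hempty : ∀ S, IsGoodSample p δ (∅ : Finset V) S := fun S => by simp [IsGoodSample]
  rcases (supp F).eq_empty_or_nonempty with he | hne
  · refine ⟨∅, by simp [he], fun c hc => ?_⟩
    obtain rfl : c = ∅ := subset_empty.1 (he ▸ subset_supp hc)
    exact hempty _
  have hl : 9 * Real.log (Fintype.card V) ≤ δ ^ 2 * p / 4 * d := by linarith
  have hsum := hF.sum_exp_le hd hV hl
  have hsupp : Real.exp (-(δ ^ 2 * p / 4 * (supp F).card)) ≤
      ((Fintype.card V : ℝ) ^ 2)⁻¹ := by
    obtain ⟨i, hi⟩ := hne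
    obtain ⟨c, hc, hic⟩ := mem_supp.1 hi
    have hds : (d : ℝ) ≤ (supp F).card := by
      exact_mod_cast (hF.le_card hc ⟨i, hic⟩).trans (card_le_card (subset_supp hc))
    have e : ((Fintype.card V : ℝ) ^ 2)⁻¹ = Real.exp (-(2 * Real.log (Fintype.card V))) := by
      rw [inv_pow_eq_exp (by linarith), Nat.cast_ofNat]
    rw [e, Real.exp_le_exp]
    have : δ ^ 2 * p / 4 * d ≤ δ ^ 2 * p / 4 * (supp F).card := by gcongr
    linarith [Real.log_nonneg (by linarith : (1 : ℝ) ≤ Fintype.card V)]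
  have hsq : ((Fintype.card V : ℝ) ^ 2)⁻¹ ≤ 1 / 9 := by
    rw [inv_eq_one_div]
    exact one_div_le_one_div_of_le (by norm_num) (by nlinarith)
  -- Adding `supp F` as an extra word makes the same union bound control the size of the sample. The
  -- total failure is at most `2 * (1/9 + 1/9) < 1`.
  obtain ⟨S, hS⟩ := CodeSparsification.exists_isGoodSample h0 h1 hδ0 hδ1
    (insert (supp F) (F.erase ∅)) (by
      rw [← mul_sum]
      have : ∑ c ∈ insert (supp F) (F.erase ∅), Real.exp (-(δ ^ 2 * p / 4 * c.card)) ≤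
          Real.exp (-(δ ^ 2 * p / 4 * (supp F).card)) +
            ∑ c ∈ F.erase ∅, Real.exp (-(δ ^ 2 * p / 4 * c.card)) := by
        by_cases h : supp F ∈ F.erase ∅
        · rw [insert_eq_of_mem h]
          linarith [Real.exp_pos (-(δ ^ 2 * p / 4 * (supp F).card))]
        · rw [sum_insert h]
      linarith)
  refine ⟨supp F ∩ S, ?_, fun c hc => ?_⟩
  · refine (hS _ (mem_insert_self _ _)).2.trans ?_
    have : 0 ≤ p * (supp F).card := by positivity
    nlinarith
  · rw [IsGoodSample, ← inter_assoc, inter_eq_left.2 (subset_supp hc)]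
    by_cases hce : c = ∅
    · rw [hce]; exact hempty S
    · exact hS c (mem_insert_of_mem (mem_erase.2 ⟨hce, hc⟩))

end Sampling

/-! ### Recursive halving of the exponent of the support size. -/

section Recursion

open Finset

variable {V : Type*} [DecidableEq V] [Fintype V]

/-- Sizes of words are estimated up to the factors `lo` and `hi` by at most `s` weights. -/
def HasWeights (F : Finset (Finset V)) (lo hi s : ℝ) : Prop :=
  ∃ w : V → ℝ, (∀ i, 0 ≤ w i) ∧ ((univ.filter (w · ≠ 0)).card : ℝ) ≤ s ∧
    ∀ c ∈ F, lo * c.card ≤ ∑ i ∈ c, w i ∧ ∑ i ∈ c, w i ≤ hi * c.card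

theorem hasWeights_one (F : Finset (Finset V)) : HasWeights F 1 1 (supp F).card := by
  refine ⟨fun i => if i ∈ supp F then 1 else 0, fun i => ?_, ?_, fun c hc => ?_⟩
  · dsimp only; split_ifs <;> norm_num
  · simp
  · have : ∑ i ∈ c, (if i ∈ supp F then (1 : ℝ) else 0) = c.card := by
      rw [sum_congr rfl fun i hi => if_pos (subset_supp hc hi)]
      simp
    simp [this]

/-- Words split along `I`; the part outside `I` is estimated from the sample `S`. -/
theorem HasWeights.combine {F : Finset (Finset V)} {lo hi s₁ s₂ p δ : ℝ} {I S : Finset V}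
    (hlo : 0 ≤ lo) (hhi : 0 ≤ hi) (hp : 0 < p) (hδ0 : 0 ≤ δ)
    (hI : HasWeights (F.image (· ∩ I)) lo hi s₁)
    (hS : HasWeights (F.image (· ∩ (S \ I))) lo hi s₂)
    (hgood : ∀ c ∈ F.image (· \ I), IsGoodSample p δ c S) :
    HasWeights F (lo * (1 - δ)) (hi * (1 + δ)) (s₁ + s₂) := by
  obtain ⟨w₁, h1, hs1, ha1⟩ := hI
  obtain ⟨w₂, h2, hs2, ha2⟩ := hS
  refine ⟨fun i => (if i ∈ I then w₁ i else 0) + (if i ∈ S \ I then w₂ i else 0) / p,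
    fun i => ?_, ?_, fun c hc => ?_⟩
  · have := h1 i
    have := h2 i
    dsimp only
    split_ifs <;> positivity
  · refine le_trans ?_ (add_le_add hs1 hs2)
    rw [← Nat.cast_add, Nat.cast_le]
    refine le_trans (card_le_card fun i hi => ?_) (card_union_le _ _)
    simp only [mem_filter, mem_univ, true_and, mem_union, ne_eq] at hi ⊢
    by_contra! h
    simp [h.1, h.2] at hi
  · have hsum : ∑ i ∈ c, ((if i ∈ I then w₁ i else 0) + (if i ∈ S \ I then w₂ i else 0) / p) =
        ∑ i ∈ c ∩ I, w₁ i + (∑ i ∈ c ∩ (S \ I), w₂ i) / p := by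
      rw [sum_add_distrib, ← sum_div, sum_ite_mem, sum_ite_mem]
    rw [hsum]
    obtain ⟨a1, b1⟩ := ha1 _ (mem_image_of_mem _ hc)
    obtain ⟨a2, b2⟩ := ha2 _ (mem_image_of_mem _ hc)
    obtain ⟨a3, b3⟩ := hgood _ (mem_image_of_mem _ hc)
    have hset : (c \ I) ∩ S = c ∩ (S \ I) := by
      ext i; simp only [mem_inter, mem_sdiff]; tauto
    rw [hset] at a3 b3
    have hcard : (c.card : ℝ) = (c ∩ I).card + (c \ I).card := by
      rw [← Nat.cast_add, card_inter_add_card_sdiff]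
    have hnn : (0 : ℝ) ≤ (c ∩ I).card := Nat.cast_nonneg _
    rw [hcard]
    constructor
    · have e1 : lo * (1 - δ) * (c ∩ I).card ≤ ∑ i ∈ c ∩ I, w₁ i := by
        refine le_trans ?_ a1
        nlinarith [mul_nonneg (mul_nonneg hlo hδ0) hnn]
      have e2 : lo * (1 - δ) * (c \ I).card ≤ (∑ i ∈ c ∩ (S \ I), w₂ i) / p := by
        rw [le_div_iff₀ hp]
        refine le_trans ?_ a2
        calc lo * (1 - δ) * (c \ I).card * p = lo * ((1 - δ) * (p * (c \ I).card)) := by ring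
          _ ≤ _ := mul_le_mul_of_nonneg_left a3 hlo
      linarith
    · have e1 : ∑ i ∈ c ∩ I, w₁ i ≤ hi * (1 + δ) * (c ∩ I).card := by
        refine b1.trans ?_
        nlinarith [mul_nonneg (mul_nonneg hhi hδ0) hnn]
      have e2 : (∑ i ∈ c ∩ (S \ I), w₂ i) / p ≤ hi * (1 + δ) * (c \ I).card := by
        rw [div_le_iff₀ hp]
        refine b2.trans ?_
        calc hi * (c ∩ (S \ I)).card ≤ hi * ((1 + δ) * (p * (c \ I).card)) :=
              mul_le_mul_of_nonneg_left b3 hhi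
          _ = _ := by ring
      linarith

/-- Each level replaces a support of size `B * X ^ 2` by two of size at most `B * X`, doubling the
number of pieces and costing one factor `1 ± δ`. -/
theorem hasWeights_of_card_supp_le {k : ℕ} {δ B : ℝ} (hk : 1 ≤ k) (hδ0 : 0 < δ) (hδ1 : δ ≤ 1)
    (hV : 3 ≤ Fintype.card V) (hB : 144 * Real.log (Fintype.card V) * k / δ ^ 2 ≤ B) (t : ℕ)
    {F : Finset (Finset V)} (hF : height F ≤ k) (hs : ((supp F).card : ℝ) ≤ B * 2 ^ 2 ^ t) :
    HasWeights F ((1 - δ) ^ t) ((1 + δ) ^ t) (2 * B * 2 ^ t) := by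
  induction t generalizing F with
  | zero =>
    obtain ⟨w, h0, h1, h2⟩ := hasWeights_one F
    exact ⟨w, h0, h1.trans (hs.trans (le_of_eq (by ring))), by simpa using h2⟩
  | succ t ih =>
    set Λ := Real.log (Fintype.card V)
    have hΛ : 1 ≤ Λ := by
      have : (3 : ℝ) ≤ Fintype.card V := by exact_mod_cast hV
      rw [Real.le_log_iff_exp_le (by linarith)]
      linarith [Real.exp_one_lt_d9]
    have hk' : (1 : ℝ) ≤ k := by exact_mod_cast hk
    set X : ℝ := 2 ^ 2 ^ t
    have hX : 1 ≤ X := one_le_pow₀ (by norm_num)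
    have hX2 : (2 : ℝ) ^ 2 ^ (t + 1) = X * X := by rw [pow_succ 2 t, pow_mul, sq]
    have hδ2 : 0 < δ ^ 2 := by positivity
    have hB0 : 0 < B := lt_of_lt_of_le (by positivity) hB
    have hy : 144 * Λ * X / δ ^ 2 ≤ B * X / k := by
      rw [le_div_iff₀ (by linarith)]
      calc 144 * Λ * X / δ ^ 2 * k = 144 * Λ * k / δ ^ 2 * X := by ring
        _ ≤ B * X := by gcongr
    have hy1 : 1 ≤ 144 * Λ * X / δ ^ 2 := by
      rw [le_div_iff₀ hδ2]
      nlinarith [mul_le_mul hΛ hX zero_le_one (by linarith : (0:ℝ) ≤ Λ)]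
    -- The largest density for which the deleted set, of size at most `d * k`, fits into `B * X`.
    set d := ⌊B * X / k⌋₊
    have hdle : (d : ℝ) ≤ B * X / k := Nat.floor_le (by positivity)
    have hd : 0 < d := Nat.floor_pos.2 (hy1.trans hy)
    have hd1 : (1 : ℝ) ≤ d := by exact_mod_cast hd
    have hdge : 72 * Λ * X ≤ δ ^ 2 * d := by
      have h1 : B * X / k < d + 1 := Nat.lt_floor_add_one _
      have h2 : 144 * Λ * X / δ ^ 2 ≤ 2 * d := by linarith
      rw [div_le_iff₀ hδ2] at h2
      linarith
    have hdk : (d : ℝ) * k ≤ B * X := by rwa [le_div_iff₀ (by linarith)] at hdle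
    -- The smallest rate the union bound allows; by `hdge` it satisfies `2 * p * X ≤ 1`, which
    -- shrinks the sample to `B * X`.
    set p := 36 * Λ / (δ ^ 2 * d) with hpdef
    have hδd : 0 < δ ^ 2 * d := by positivity
    have hp0 : 0 < p := by positivity
    have hp1 : p ≤ 1 := by
      rw [hpdef, div_le_one hδd]
      nlinarith
    obtain ⟨I, hIc, hId⟩ := exists_isDense_sdiff d F
    obtain ⟨S, hSc, hSg⟩ := hId.exists_isGoodSample (p := p) (δ := δ) hd hV hp0.le hp1 hδ0.le hδ1
      (le_of_eq (by rw [hpdef]; field_simp; rfl))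
    have h1 : HasWeights (F.image (· ∩ I)) ((1 - δ) ^ t) ((1 + δ) ^ t) (2 * B * 2 ^ t) := by
      refine ih ((height_image_inter_le F I).trans hF) ?_
      have : (supp (F.image (· ∩ I))).card ≤ d * k :=
        (card_le_card (supp_image_inter_subset F I)).trans (hIc.trans (Nat.mul_le_mul_left _ hF))
      refine le_trans ?_ hdk
      exact_mod_cast this
    have h2 : HasWeights (F.image (· ∩ (S \ I))) ((1 - δ) ^ t) ((1 + δ) ^ t) (2 * B * 2 ^ t) := by
      refine ih ((height_image_inter_le F _).trans hF) ?_
      have e1 : ((supp (F.image (· ∩ (S \ I)))).card : ℝ) ≤ S.card := by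
        exact_mod_cast card_le_card ((supp_image_inter_subset F _).trans sdiff_subset)
      have e2 : ((supp (F.image (· \ I))).card : ℝ) ≤ B * (X * X) := by
        rw [← hX2]
        refine le_trans ?_ hs
        exact_mod_cast card_le_card (supp_image_sdiff_subset F I)
      calc _ ≤ 2 * p * (supp (F.image (· \ I))).card := e1.trans hSc
        _ ≤ 2 * p * (B * (X * X)) := by gcongr
        _ = (72 * Λ * X) / (δ ^ 2 * d) * (B * X) := by rw [hpdef]; ring
        _ ≤ 1 * (B * X) := by
          gcongr
          rwa [div_le_one hδd]
        _ = B * X := one_mul _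
    have h := h1.combine (pow_nonneg (by linarith) t) (by positivity) hp0 hδ0.le h2 hSg
    rw [← pow_succ, ← pow_succ] at h
    convert h using 1
    ring

end Recursion

/-! ### Numerical estimates and translation to codes. -/

section Main

theorem one_lt_log_of_three_le {m : ℕ} (hm : 3 ≤ m) : 1 < Real.log m := by
  have : (3 : ℝ) ≤ m := by exact_mod_cast hm
  rw [Real.lt_log_iff_exp_lt (by linarith)]
  linarith [Real.exp_one_lt_d9]

theorem exists_le_two_pow_two_pow :
    ∃ K : ℝ, 0 < K ∧ ∀ m : ℕ, 3 ≤ m → ∃ T : ℕ, 1 ≤ T ∧ m ≤ 2 ^ 2 ^ T ∧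
      (2 : ℝ) ^ T ≤ 6 * Real.log m ∧ (T : ℝ) ≤ K * Real.log (Real.log m) := by
  have hl3 : 0 < Real.log (Real.log 3) := Real.log_pos (by
    simpa using one_lt_log_of_three_le le_rfl)
  have hlog2 : 0.5 < Real.log 2 := by linarith [Real.log_two_gt_d9]
  -- The estimate is `T ≤ 6 + 2 * log (log m)`; the first term of the constant absorbs the 6, as
  -- `log (log m) ≥ log (log 3) > 0`.
  refine ⟨6 / Real.log (Real.log 3) + 2, by positivity, fun m hm => ?_⟩
  have hm' : (3 : ℝ) ≤ m := by exact_mod_cast hm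
  have hlm := one_lt_log_of_three_le hm
  set b := Nat.clog 2 m
  have hb : m ≤ 2 ^ b := Nat.le_pow_clog one_lt_two m
  have hb2 : 2 ≤ b := by
    by_contra h
    have : 2 ^ b ≤ 2 ^ 1 := Nat.pow_le_pow_right two_pos (by omega)
    omega
  have hb' : (b : ℝ) ≤ 3 * Real.log m := by
    have h : 2 ^ (b - 1) < m := Nat.pow_pred_clog_lt_self one_lt_two (by omega)
    have h1 : ((b - 1 : ℕ) : ℝ) * Real.log 2 ≤ Real.log m := by
      rw [← Real.log_pow]
      exact Real.log_le_log (by positivity) (by exact_mod_cast h.le)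
    rw [Nat.cast_sub (by omega), Nat.cast_one] at h1
    have : (2 : ℝ) ≤ b := by exact_mod_cast hb2
    nlinarith
  set T := Nat.clog 2 b
  have hT : b ≤ 2 ^ T := Nat.le_pow_clog one_lt_two b
  have hT1 : 1 ≤ T := by
    by_contra h
    have : 2 ^ T ≤ 2 ^ 0 := Nat.pow_le_pow_right two_pos (by omega)
    omega
  have hTb : (2 : ℝ) ^ (T - 1) ≤ 3 * Real.log m := by
    have h : 2 ^ (T - 1) < b := Nat.pow_pred_clog_lt_self one_lt_two (by omega)
    refine le_trans ?_ hb'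
    exact_mod_cast h.le
  refine ⟨T, hT1, hb.trans (Nat.pow_le_pow_right two_pos hT), ?_, ?_⟩
  · obtain ⟨s, hs⟩ := Nat.exists_eq_add_of_le' hT1
    rw [hs, Nat.add_sub_cancel] at hTb
    rw [hs, pow_succ]
    linarith
  · have h1 : ((T - 1 : ℕ) : ℝ) * Real.log 2 ≤ Real.log (3 * Real.log m) := by
      rw [← Real.log_pow]
      exact Real.log_le_log (by positivity) hTb
    rw [Real.log_mul (by norm_num) (by linarith), Nat.cast_sub hT1, Nat.cast_one] at h1
    have h3 : Real.log 3 ≤ 2 := by linarith [Real.log_le_sub_one_of_pos (by norm_num : (0:ℝ) < 3)]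
    have hl3' : 0 < Real.log 3 := Real.log_pos (by norm_num)
    have hll : Real.log (Real.log 3) ≤ Real.log (Real.log m) :=
      Real.log_le_log hl3' (Real.log_le_log (by norm_num) hm')
    have h6 : 6 ≤ 6 / Real.log (Real.log 3) * Real.log (Real.log m) := by
      calc (6 : ℝ) = 6 / Real.log (Real.log 3) * Real.log (Real.log 3) := by field_simp
        _ ≤ _ := by gcongr
    have : (1 : ℝ) ≤ T := by exact_mod_cast hT1
    nlinarith

/-- The family of the supports of the codewords. -/
noncomputable def supports {m : ℕ} (C : Code m) : Finset (Finset (Fin m)) :=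
  C.toFinite.toFinset.image fun c => Finset.univ.filter (c · = true)

theorem support_mem_supports {m : ℕ} {C : Code m} {c : Fin m → Bool} (hc : c ∈ C) :
    Finset.univ.filter (c · = true) ∈ supports C :=
  Finset.mem_image_of_mem _ (by simpa using hc)

theorem height_supports_le {m : ℕ} (C : Code m) : height (supports C) ≤ chainLength C := by
  obtain ⟨a, c, hc, hd, ha⟩ := (hasChain_height (supports C)).exists_maps
  refine (chainLength_isGreatest C).2 ?_
  have hC : ∀ i, ∃ e ∈ C, Finset.univ.filter (e · = true) = c i := fun i => by
    simpa [supports] using hc i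
  choose e he hce using hC
  have hmem : ∀ i x, x ∈ c i ↔ e i x = true := fun i x => by simp [← hce i]
  have hdiag : ∀ i, e i (a i) = true := fun i => (hmem _ _).1 (hd i)
  have habove : ∀ i j, i < j → e i (a j) = false := fun i j hij =>
    Bool.eq_false_iff.2 fun h => ha i j hij ((hmem _ _).2 h)
  -- Injectivity of both maps is automatic from the triangular pattern of zeros and ones.
  refine ⟨a, e, .of_lt_imp_ne fun i j hij h => ?_,
    .of_lt_imp_ne fun i j hij h => ?_, he, hdiag, habove⟩
  · have := habove i j hij
    rw [← h, hdiag] at this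
    exact Bool.noConfusion this
  · have := habove i j hij
    rw [h, hdiag] at this
    exact Bool.noConfusion this

theorem weight_eq_sum {m : ℕ} (w : Fin m → ℝ) (c : Fin m → Bool) :
    weight w c = ∑ i ∈ Finset.univ.filter (c · = true), w i := by
  simp [weight, Finset.sum_filter]

theorem weight_one {m : ℕ} (c : Fin m → Bool) :
    weight (fun _ => 1) c = (Finset.univ.filter (c · = true)).card := by
  simp [weight_eq_sum]

theorem numRetained_eq {m : ℕ} (w : Fin m → ℝ) :
    numRetained w = (Finset.univ.filter (w · ≠ 0)).card := by
  rw [numRetained, ← Set.ncard_coe_finset]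
  congr 1
  ext; simp

theorem HasWeights.exists_isSparsifier {m : ℕ} {C : Code m} {ε lo hi s : ℝ}
    (h : HasWeights (supports C) lo hi s) (hlo : 1 - ε ≤ lo) (hhi : hi ≤ 1 + ε) :
    ∃ w : Fin m → ℝ, IsSparsifier C (fun _ => 1) ε w ∧ (numRetained w : ℝ) ≤ s := by
  obtain ⟨w, h0, hs, ha⟩ := h
  refine ⟨w, ⟨h0, fun c hc => ?_⟩, by rwa [numRetained_eq]⟩
  obtain ⟨h1, h2⟩ := ha _ (support_mem_supports hc)
  rw [weight_one, weight_eq_sum]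
  exact ⟨le_trans (by gcongr) h1, h2.trans (by gcongr)⟩

theorem hasWeights_zero_of_height_eq_zero {V : Type*} [DecidableEq V] [Fintype V]
    {F : Finset (Finset V)} (hF : height F = 0) : HasWeights F 1 1 0 := by
  have h : supp F = ∅ := Finset.eq_empty_of_forall_notMem fun i hi => (height_pos hi).ne' hF
  simpa [h] using hasWeights_one F

theorem one_add_pow_le {T : ℕ} {ε : ℝ} (hT : 1 ≤ T) (h0 : 0 < ε) (h1 : ε ≤ 1) :
    (1 + ε / (2 * T)) ^ T ≤ 1 + ε := by
  have hT' : (T : ℝ) ≠ 0 := by positivity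
  calc (1 + ε / (2 * T)) ^ T ≤ Real.exp (ε / (2 * T)) ^ T := by
        gcongr
        linarith [Real.add_one_le_exp (ε / (2 * T))]
    _ = Real.exp (ε / 2) := by
        rw [← Real.exp_nat_mul]
        congr 1
        field_simp
    _ ≤ 1 + ε := by
        have := (abs_le.1 (Real.abs_exp_sub_one_sub_id_le (x := ε / 2)
          (by rw [abs_le]; constructor <;> linarith))).2
        nlinarith

theorem le_one_sub_pow {T : ℕ} {ε : ℝ} (hT : 1 ≤ T) (h0 : 0 < ε) (h1 : ε ≤ 1) :
    1 - ε ≤ (1 - ε / (2 * T)) ^ T := by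
  have hT' : (1 : ℝ) ≤ T := by exact_mod_cast hT
  have h2 : ε / (2 * T) ≤ 1 := by rw [div_le_one (by positivity)]; linarith
  have h3 := one_add_mul_le_pow (a := -(ε / (2 * T))) (by linarith) T
  have h4 : (T : ℝ) * (ε / (2 * T)) = ε / 2 := by field_simp
  rw [← sub_eq_add_neg] at h3
  linarith

end Main

end CodeSparsification

theorem mainTheorem3 :
    ∃ K : ℝ, 0 < K ∧
      ∀ (m : ℕ), 3 ≤ m →
        ∀ (C : CodeSparsification.Code m) (ε : ℝ), 0 < ε →
          ∃ w' : Fin m → ℝ,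
            CodeSparsification.IsSparsifier C (fun _ => 1) ε w' ∧
            (CodeSparsification.numRetained w' : ℝ) ≤
              K * ((CodeSparsification.chainLength C : ℝ) * Real.log (m : ℝ) ^ 2 *
                Real.log (Real.log (m : ℝ)) ^ 2 / ε ^ 2) := by
  open CodeSparsification in
  obtain ⟨K, hK, hT⟩ := exists_le_two_pow_two_pow
  -- Here `6912 = 2 * 144 * 4 * 6`: the leaf size `2 * B`, the constant in `B`, the square of the 2
  -- in `δ`, and `2 ^ T ≤ 6 * log m`.
  refine ⟨6912 * K ^ 2, by positivity, fun m hm C ε hε => ?_⟩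
  rcases lt_or_ge 1 ε with h1 | h1
  -- For `ε > 1` the lower bound is nonpositive, so zero weights suffice.
  · refine ⟨fun _ => 0, ⟨fun _ => le_rfl, fun c _ => ?_⟩, ?_⟩
    · have : (0 : ℝ) ≤ (Finset.univ.filter (c · = true)).card := Nat.cast_nonneg _
      rw [weight_one, weight_eq_sum, Finset.sum_const_zero]
      constructor <;> nlinarith
    · have : numRetained (fun _ : Fin m => (0 : ℝ)) = 0 := by simp [numRetained_eq]
      rw [this, Nat.cast_zero]
      positivity
  rcases (chainLength C).eq_zero_or_pos with hk | hk
  · have h0 : height (supports C) = 0 := by have := height_supports_le C; omega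
    obtain ⟨w, hw, hs⟩ := (hasWeights_zero_of_height_eq_zero h0).exists_isSparsifier
      (ε := ε) (by linarith) (by linarith)
    exact ⟨w, hw, hs.trans (by positivity)⟩
  obtain ⟨T, hT1, hTm, hTpow, hTlog⟩ := hT m hm
  have hlm := one_lt_log_of_three_le hm
  have hT' : (1 : ℝ) ≤ T := by exact_mod_cast hT1
  have hk' : (1 : ℝ) ≤ chainLength C := by exact_mod_cast hk
  set δ := ε / (2 * T) with hδ
  have hδ0 : 0 < δ := by positivity
  have hδ1 : δ ≤ 1 := by rw [hδ, div_le_one (by positivity)]; linarith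
  set B := 144 * Real.log m * chainLength C / δ ^ 2 with hB
  have hB1 : 1 ≤ B := by
    rw [hB, le_div_iff₀ (by positivity)]
    have : δ ^ 2 ≤ 1 := pow_le_one₀ hδ0.le hδ1
    nlinarith
  have hsupp : ((supp (supports C)).card : ℝ) ≤ B * 2 ^ 2 ^ T := by
    have h2 : ((supp (supports C)).card : ℝ) ≤ 2 ^ 2 ^ T := by
      refine le_trans ?_ (by exact_mod_cast hTm : (m : ℝ) ≤ 2 ^ 2 ^ T)
      exact_mod_cast (Finset.card_le_univ _).trans_eq (Fintype.card_fin m)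
    exact h2.trans (le_mul_of_one_le_left (by positivity) hB1)
  obtain ⟨w, hw, hs⟩ := (hasWeights_of_card_supp_le hk hδ0 hδ1 (by simpa using hm)
    (by rw [Fintype.card_fin]) T (height_supports_le C) hsupp).exists_isSparsifier
    (le_one_sub_pow hT1 hε h1) (one_add_pow_le hT1 hε h1)
  refine ⟨w, hw, hs.trans ?_⟩
  calc 2 * B * 2 ^ T ≤ 2 * B * (6 * Real.log m) := by gcongr
    _ = 6912 * (T : ℝ) ^ 2 * (chainLength C * Real.log m ^ 2 / ε ^ 2) := by
        rw [hB, hδ]; field_simp; norm_num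
    _ ≤ 6912 * (K * Real.log (Real.log m)) ^ 2 * (chainLength C * Real.log m ^ 2 / ε ^ 2) := by
        gcongr
    _ = _ := by ring
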